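/- Let $G$ be an abelian group and $A\subseteq G$ a finite set. For finite sets $X,Y\subseteq G$ let $r_{X-Y}(x)=|\{(a,b)\in X\times Y: a-b=x\}|$, and for an integer $k\ge 2$ let $E_k(A)=\sum_{x\in G} r_{A-A}(x)^k$. Write $H\dotplus Z$ for the sumset $H+Z$ when the sum is direct, i.e. when $|H+Z|=|H||Z|$. In what follows $X\ll Y$ (equivalently $Y\gg X$) means $X\le CY$, and $Y\gtrsim X$ means $X\le C\,Y(\log_2|A|)^{C}$, where $C>0$ is one absolute constant, independent of $G,A,\varepsilon,\delta$. There is an absolute constant $C>0$ such that the following holds for all real $0<\varepsilon\le\delta\le 1$. 1) There is an integer $k=k(\delta,\varepsilon)\ge 2$ with $k\le\max\{2,\exp(C\varepsilon^{-1}\log_2(1/\delta))\}$ such that for every abelian group $G$ and every finite $A\subseteq G$, either $E_k(A)\le |A|^{k+\delta}$, or there are finite sets $H,Z\subseteq G$ such that the sum of $H$ and $Z$ is direct and $$|H|\gtrsim |A|^{\delta(1-\varepsilon)},\qquad |H+H|\ll |A|^{\varepsilon}|H|,\qquad |Z||H|\ll |A|^{1+\varepsilon},\qquad |(H\dotplus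 Z)\cap A|\gg |A|^{1-\varepsilon}.$$ 2) There is an integer $k=k(\delta,\varepsilon)$ with $2\le k\le C/\varepsilon$ such that for every abelian group $G$ and every finite $A\subseteq G$, either $E_k(A)\le |A|^{k+\delta}$, or there are a set $A'\subseteq A$ and a finite set $P\subseteq G$ such that $$|A'|\gg |A|^{1-\varepsilon},\qquad |P|\gtrsim |A|^{\delta},\qquad r_{A-P}(x)\gg |P||A|^{-\varepsilon}\ \text{ for all } x\in A'.$$ -/

import Mathlib

open scoped Pointwise Finset

universe u

/-- The representation function `r_{A-B}(x)`: the number of pairs `(a, b) ∈ A × B` with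
`a - b = x`. -/
def diffRep {G : Type u} [AddCommGroup G] [DecidableEq G] (A B : Finset G) (x : G) : ℕ :=
  #{p ∈ A ×ˢ B | p.1 - p.2 = x}

/-- The higher energy `E_k(A) = ∑_x r_{A-A}(x)^k`, used for `k ≥ 2`. The sum runs over the
difference set `A - A`, since `r_{A-A}` vanishes outside it. -/
def higherEnergy {G : Type u} [AddCommGroup G] [DecidableEq G] (k : ℕ) (A : Finset G) : ℕ :=
  ∑ x ∈ A - A, diffRep A A x ^ k

/-- The sum of `H` and `Z` is direct: `|H + Z| = |H| |Z|`. -/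
def IsDirectSumset {G : Type u} [AddCommGroup G] [DecidableEq G] (H Z : Finset G) : Prop :=
  #(H + Z) = #H * #Z

/-! Write n = |A|, m = k - 1, and suppose E_k(A) > n^(k+δ). Choose θ with θ^m = n^(δ-1)/2.
Differences with fewer than θn representations contribute at most n^(k+δ)/2, so the set P of
θn-popular differences has at least n^δ/2 elements; for large k, θ is at worst a small negative
power of n. Double counting gives at least θn/2 elements a of A with |(a + P) ∩ A| ≥ θ|P|/2, which
is the second assertion.

For the first, popularity is almost closed under subtraction: by Cauchy–Schwarz a proportion ≫ θ² of
the pairs in P have a θ³n-popular difference (`le_card_filter_sub_popular`). Let P_j be the set of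
θ^(3^j)n-popular differences. Since |P_0| ≥ n^δ/2 and |P_j| ≤ n/θ^(3^j), the sizes cannot grow by a
power at every step (`exists_slow_growth`). Where growth is slow, many pairs in P_j have differences
in a set hardly larger than P_j, and Balog–Szemerédi–Gowers (`exists_subset_card_sub_le`) yields H ⊆
P_j of small doubling. As H consists of popular differences, many translates a + H meet A
substantially, and a maximal disjoint family of them gives Z (`exists_isDirectSumset`).

The number of steps is of order ε⁻¹ log(1/δ), hence k is exponential in it. If that quantity is
below 1/20, then δ is so close to 1 that k = 2 and Balog–Szemerédi–Gowers on A itself suffice, with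
Z = {0}. -/

/-! ### The Balog–Szemerédi–Gowers theorem -/

/-- In a bipartite graph of density `α` on `A × A` there is a large set `H` of vertices any two of
which are joined by many paths of length four. -/
theorem exists_subset_forall_many_paths {V : Type*} (A : Finset V) (E : V → V → Prop)
    [DecidableRel E] [DecidableEq V] (hA : A.Nonempty) {α : ℝ} (hα : 0 < α)
    (hE : α * (#A : ℝ) ^ 2 ≤ ∑ b ∈ A, (#{a ∈ A | E a b} : ℝ)) :
    ∃ H ⊆ A, α / 4 * #A ≤ #H ∧ ∀ a ∈ H, ∀ a' ∈ H, α ^ 5 / 1024 * (#A : ℝ) ^ 3 ≤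
      (#{t ∈ A ×ˢ A ×ˢ A | (E a t.2.1 ∧ E t.1 t.2.1) ∧ (E a' t.2.2 ∧ E t.1 t.2.2)} : ℝ) := by
  classical
  have hn : (0 : ℝ) < #A := by exact_mod_cast hA.card_pos
  set n : ℝ := (#A : ℝ)
  set codeg : V → V → Finset V := fun a c => {b ∈ A | E a b ∧ E c b} with hcodeg
  set Bad : V → V → Prop := fun a c => (#(codeg a c) : ℝ) < α ^ 2 / 16 * n with hBad
  set N : V → Finset V := fun b => {a ∈ A | E a b} with hN
  set bad : V → Finset (V × V) := fun b => {p ∈ N b ×ˢ N b | Bad p.1 p.2} with hbad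
  have hsq : α ^ 2 * n ^ 3 ≤ ∑ b ∈ A, (#(N b) : ℝ) ^ 2 := by
    have h := sq_sum_le_card_mul_sum_sq (s := A) (f := fun b => (#(N b) : ℝ))
    have h2 : (α * n ^ 2) ^ 2 ≤ (∑ b ∈ A, (#(N b) : ℝ)) ^ 2 := by
      gcongr
    have h3 : n * (α ^ 2 * n ^ 3) ≤ n * ∑ b ∈ A, (#(N b) : ℝ) ^ 2 := by
      calc n * (α ^ 2 * n ^ 3) = (α * n ^ 2) ^ 2 := by ring
        _ ≤ _ := h2.trans h
    exact le_of_mul_le_mul_left h3 hn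
  have hbadsum : ∑ b ∈ A, (#(bad b) : ℝ) ≤ α ^ 2 / 16 * n ^ 3 := by
    have h1 : ∑ b ∈ A, #(bad b) = ∑ p ∈ (A ×ˢ A).filter (fun p => Bad p.1 p.2),
        #(codeg p.1 p.2) := by
      have := Finset.sum_card_bipartiteAbove_eq_sum_card_bipartiteBelow
        (s := A) (t := (A ×ˢ A).filter (fun p => Bad p.1 p.2))
        (r := fun b p => E p.1 b ∧ E p.2 b)
      convert this using 2 with b hb
      · congr 1
        ext p
        simp only [hbad, hN, Finset.mem_filter, Finset.mem_product, Finset.bipartiteAbove]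
        tauto
      · rfl
    have h2 : ∑ b ∈ A, (#(bad b) : ℝ) = ∑ p ∈ (A ×ˢ A).filter (fun p => Bad p.1 p.2),
        (#(codeg p.1 p.2) : ℝ) := by exact_mod_cast h1
    rw [h2]
    calc _ ≤ ∑ p ∈ (A ×ˢ A).filter (fun p => Bad p.1 p.2), α ^ 2 / 16 * n := by
          apply Finset.sum_le_sum
          intro p hp
          exact (Finset.mem_filter.1 hp).2.le
      _ ≤ ∑ p ∈ A ×ˢ A, α ^ 2 / 16 * n := by
          apply Finset.sum_le_sum_of_subset_of_nonneg (Finset.filter_subset _ _)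
          intros; positivity
      _ = _ := by
          rw [Finset.sum_const, Finset.card_product, nsmul_eq_mul]; push_cast; ring
  -- Averaging with penalty 8 makes both terms useful: U = N(b) has size at least αn/2, and at most
  -- |U|²/8 of its pairs are bad, so at least half of U has at most |U|/4 bad partners.
  obtain ⟨b, hbA, hb⟩ : ∃ b ∈ A, α ^ 2 / 2 * n ^ 2 ≤ (#(N b) : ℝ) ^ 2 - 8 * #(bad b) := by
    apply Finset.exists_le_of_sum_le hA
    have h1 : ∑ b ∈ A, 8 * (#(bad b) : ℝ) = 8 * ∑ b ∈ A, (#(bad b) : ℝ) :=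
      (Finset.mul_sum _ _ _).symm
    have h2 : (#A : ℝ) * (α ^ 2 / 2 * n ^ 2) = α ^ 2 / 2 * n ^ 3 := by ring
    rw [Finset.sum_sub_distrib, Finset.sum_const, nsmul_eq_mul, h1, h2]
    linarith
  set U := N b with hU
  have hUA : U ⊆ A := Finset.filter_subset _ _
  have hbad0 : (0 : ℝ) ≤ #(bad b) := by positivity
  have hUn : α * n / 2 ≤ #U := by
    apply le_of_sq_le_sq _ (by positivity)
    nlinarith [sq_nonneg (α * n)]
  have hU0 : (0 : ℝ) < #U := lt_of_lt_of_le (by positivity) hUn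
  set d : V → Finset V := fun a => {c ∈ U | Bad a c} with hd
  have hdsum : ∑ a ∈ U, (#(d a) : ℝ) = #(bad b) := by
    have : #(bad b) = ∑ a ∈ U, #(d a) := by
      simp only [hbad, hd, ← hU, Finset.card_filter, Finset.sum_product]
    rw [this]; push_cast; rfl
  set H : Finset V := {a ∈ U | (#(d a) : ℝ) ≤ #U / 4} with hH
  have hHU : (#U : ℝ) / 2 ≤ #H := by
    have h1 : (#({a ∈ U | ¬ (#(d a) : ℝ) ≤ #U / 4}) : ℝ) * (#U / 4) ≤ #(bad b) := by
      rw [← hdsum, ← nsmul_eq_mul, ← Finset.sum_const]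
      calc _ ≤ ∑ a ∈ U with ¬ (#(d a) : ℝ) ≤ #U / 4, (#(d a) : ℝ) := by
            apply Finset.sum_le_sum
            intro a ha
            exact (not_le.1 (Finset.mem_filter.1 ha).2).le
        _ ≤ _ := by
            apply Finset.sum_le_sum_of_subset_of_nonneg (Finset.filter_subset _ _)
            intros; positivity
    have h2 : (#H : ℝ) + #({a ∈ U | ¬ (#(d a) : ℝ) ≤ #U / 4}) = #U := by
      exact_mod_cast Finset.card_filter_add_card_filter_not (s := U) _
    have h3 : 0 ≤ α ^ 2 / 2 * n ^ 2 := by positivity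
    by_contra! hlt
    nlinarith
  refine ⟨H, (Finset.filter_subset _ _).trans hUA, by linarith, ?_⟩
  intro a ha a' ha'
  -- Midpoints c of the paths a, b, c, b', a': each c in T leaves at least α²n/16 choices for b and,
  -- independently, for b'.
  set T : Finset V := {c ∈ U | ¬ Bad a c ∧ ¬ Bad a' c} with hT
  have hTU : (#U : ℝ) / 2 ≤ #T := by
    have h1 : #U ≤ #T + (#(d a) + #(d a')) := by
      calc #U ≤ #(T ∪ (d a ∪ d a')) := by
            apply Finset.card_le_card
            intro c hc
            simp only [hT, hd, Finset.mem_union, Finset.mem_filter]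
            tauto
        _ ≤ _ := (Finset.card_union_le _ _).trans (by gcongr; exact Finset.card_union_le _ _)
    have h1' : (#U : ℝ) ≤ #T + (#(d a) + #(d a')) := by exact_mod_cast h1
    have h2 := (Finset.mem_filter.1 ha).2
    have h3 := (Finset.mem_filter.1 ha').2
    linarith
  have hcount : ∑ c ∈ T, #(codeg a c) * #(codeg a' c) ≤
      #{t ∈ A ×ˢ A ×ˢ A | (E a t.2.1 ∧ E t.1 t.2.1) ∧ (E a' t.2.2 ∧ E t.1 t.2.2)} := by
    simp only [← Finset.card_product]
    rw [← Finset.card_sigma]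
    apply Finset.card_le_card_of_injOn (fun s => (s.1, s.2))
    · rintro ⟨c, q⟩ h
      have hTA : T ⊆ A := (Finset.filter_subset _ _).trans hUA
      simp only [Finset.coe_sigma, Set.mem_sigma_iff, Finset.mem_coe, Finset.mem_product, hcodeg,
        Finset.mem_filter] at h ⊢
      exact ⟨⟨hTA h.1, h.2.1.1, h.2.2.1⟩, h.2.1.2, h.2.2.2⟩
    · rintro ⟨c, q⟩ _ ⟨c', q'⟩ _ h
      simp only [Prod.mk.injEq] at h
      obtain ⟨rfl, rfl⟩ := h
      rfl
  calc α ^ 5 / 1024 * n ^ 3 = (α * n / 2 / 2) * ((α ^ 2 / 16 * n) * (α ^ 2 / 16 * n)) := by ring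
    _ ≤ #T * ((α ^ 2 / 16 * n) * (α ^ 2 / 16 * n)) := by
        gcongr; linarith
    _ = ∑ c ∈ T, (α ^ 2 / 16 * n) * (α ^ 2 / 16 * n) := by
        rw [Finset.sum_const, nsmul_eq_mul]
    _ ≤ ∑ c ∈ T, (#(codeg a c) : ℝ) * #(codeg a' c) := by
        apply Finset.sum_le_sum
        intro c hc
        have h := (Finset.mem_filter.1 hc).2
        have h1 := not_lt.1 h.1
        have h2 := not_lt.1 h.2
        gcongr
    _ ≤ _ := by exact_mod_cast hcount

section

variable {G : Type u} [AddCommGroup G] [DecidableEq G]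

/-- The Balog–Szemerédi–Gowers theorem for the differences along a dense graph. -/
theorem exists_subset_card_sub_le {A S : Finset G} (hA : A.Nonempty) {α K : ℝ} (hα : 0 < α)
    (hE : α * (#A : ℝ) ^ 2 ≤ (#{p ∈ A ×ˢ A | p.1 - p.2 ∈ S} : ℝ)) (hS : (#S : ℝ) ≤ K * #A) :
    ∃ H ⊆ A, α / 4 * #A ≤ #H ∧ (#(H - H) : ℝ) ≤ 4096 * K ^ 4 / α ^ 6 * #H := by
  have hn : (0 : ℝ) < #A := by exact_mod_cast hA.card_pos
  obtain ⟨H, hHA, hH, hpaths⟩ := exists_subset_forall_many_paths A (fun a b => a - b ∈ S) hA hα (by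
    refine hE.trans (le_of_eq ?_)
    rw [Finset.card_filter, Finset.sum_product_right]
    push_cast
    simp only [Finset.card_filter]
    push_cast
    rfl)
  refine ⟨H, hHA, hH, ?_⟩
  -- Along a path a, b, c, b', a' the combination (a - b) - (c - b) - ((a' - b') - (c - b')) equals
  -- a - a'. For fixed a, a' the four differences determine the path, so each element of H - H uses
  -- up many quadruples of S⁴.
  set f : G × G × G × G → G := fun s => (s.1 - s.2.1) - (s.2.2.1 - s.2.2.2) with hf
  have hfib : ∀ x ∈ H - H, α ^ 5 / 1024 * (#A : ℝ) ^ 3 ≤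
      (#{s ∈ S ×ˢ S ×ˢ S ×ˢ S | f s = x} : ℝ) := by
    intro x hx
    obtain ⟨a, ha, a', ha', rfl⟩ := Finset.mem_sub.1 hx
    refine (hpaths a ha a' ha').trans ?_
    norm_cast
    apply Finset.card_le_card_of_injOn
      (fun t => (a - t.2.1, t.1 - t.2.1, a' - t.2.2, t.1 - t.2.2))
    · rintro ⟨c, b, b'⟩ h
      simp only [Finset.coe_filter, Set.mem_ofPred_eq, Finset.mem_product, hf] at h ⊢
      refine ⟨⟨h.2.1.1, h.2.1.2, h.2.2.1, h.2.2.2⟩, by abel⟩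
    · rintro ⟨c, b, b'⟩ _ ⟨c', d, d'⟩ _ h
      simp only [Prod.mk.injEq, sub_right_inj] at h
      obtain ⟨rfl, h1, rfl, -⟩ := h
      simp only [sub_left_inj] at h1
      rw [h1]
  have htotal : (#(H - H) : ℝ) * (α ^ 5 / 1024 * (#A : ℝ) ^ 3) ≤ (#S : ℝ) ^ 4 := by
    rw [← nsmul_eq_mul, ← Finset.sum_const]
    refine (Finset.sum_le_sum hfib).trans ?_
    have h : ∑ x ∈ H - H, #{s ∈ S ×ˢ S ×ˢ S ×ˢ S | f s = x} ≤ #(S ×ˢ S ×ˢ S ×ˢ S) := by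
      rw [← Finset.card_biUnion]
      · apply Finset.card_le_card
        intro s hs
        obtain ⟨x, -, hx⟩ := Finset.mem_biUnion.1 hs
        exact (Finset.mem_filter.1 hx).1
      · intro x _ y _ hxy
        apply Finset.disjoint_filter.2
        rintro s _ rfl h
        exact hxy h
    have h' : #(S ×ˢ S ×ˢ S ×ˢ S) = #S ^ 4 := by
      simp only [Finset.card_product]; ring
    rw [h'] at h
    exact_mod_cast h
  have hS4 : (#S : ℝ) ^ 4 ≤ K ^ 4 * (#A : ℝ) ^ 4 := by
    rw [← mul_pow]; gcongr
  have h1 : (#(H - H) : ℝ) * (α ^ 5 / 1024) ≤ K ^ 4 * #A := by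
    have h3 : (0 : ℝ) < (#A : ℝ) ^ 3 := by positivity
    apply le_of_mul_le_mul_right _ h3
    calc _ = (#(H - H) : ℝ) * (α ^ 5 / 1024 * (#A : ℝ) ^ 3) := by ring
      _ ≤ _ := htotal.trans hS4
      _ = _ := by ring
  have h2 : (#(H - H) : ℝ) ≤ 1024 * K ^ 4 / α ^ 5 * #A := by
    rw [div_mul_eq_mul_div, le_div_iff₀ (by positivity)]
    linarith
  have h4 : (#A : ℝ) ≤ 4 / α * #H := by
    rw [div_mul_eq_mul_div, le_div_iff₀ hα]; linarith
  have hK4 : 0 ≤ K ^ 4 := by positivity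
  calc _ ≤ _ := h2
    _ ≤ 1024 * K ^ 4 / α ^ 5 * (4 / α * #H) := by gcongr
    _ = _ := by field_simp; ring

/-- The Plünnecke–Ruzsa inequality for 2H - 0H turns small difference set into small doubling. -/
theorem card_add_self_le_of_card_sub_self_le {H : Finset G} (hH : H.Nonempty) {D : ℝ}
    (hD : (#(H - H) : ℝ) ≤ D * #H) : (#(H + H) : ℝ) ≤ D ^ 2 * #H := by
  have h := Finset.pluennecke_ruzsa_inequality_nsmul_sub_nsmul_sub hH H 2 0
  simp only [two_nsmul, zero_nsmul, sub_zero] at h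
  have h' : (#(H + H) : ℝ) ≤ ((#(H - H) : ℝ) / #H) ^ 2 * #H := by
    have := (NNRat.cast_le (K := ℝ)).2 h
    push_cast at this
    simpa using this
  have hn : (0 : ℝ) < #H := by exact_mod_cast hH.card_pos
  refine h'.trans ?_
  gcongr
  rwa [div_le_iff₀ hn]

/-! ### Representation counts and popular differences -/

theorem diffRep_eq_card_filter (A B : Finset G) (x : G) :
    diffRep A B x = #{b ∈ B | x + b ∈ A} := by
  unfold diffRep
  apply Finset.card_nbij' (fun p => p.2) (fun b => (x + b, b))
  · rintro ⟨a, b⟩ h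
    simp only [Finset.coe_filter, Finset.mem_product, Set.mem_ofPred_eq] at h ⊢
    obtain ⟨⟨h1, h2⟩, rfl⟩ := h
    simpa using ⟨h2, h1⟩
  · intro b h
    simp only [Finset.coe_filter, Finset.mem_product, Set.mem_ofPred_eq] at h ⊢
    exact ⟨⟨h.2, h.1⟩, by abel⟩
  · rintro ⟨a, b⟩ h
    simp only [Finset.coe_filter, Finset.mem_product, Set.mem_ofPred_eq] at h
    obtain ⟨⟨h1, h2⟩, rfl⟩ := h
    simp
  · intro b h
    rfl

theorem diffRep_le_card (A B : Finset G) (x : G) : diffRep A B x ≤ #B := by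
  rw [diffRep_eq_card_filter]
  exact Finset.card_filter_le _ _

theorem sum_diffRep_eq_card (A S : Finset G) :
    ∑ x ∈ S, diffRep A A x = #{p ∈ A ×ˢ A | p.1 - p.2 ∈ S} := by
  unfold diffRep
  rw [← Finset.card_biUnion]
  · congr 1
    ext p
    simp only [Finset.mem_biUnion, Finset.mem_filter]
    constructor
    · rintro ⟨x, hx, hp, rfl⟩
      exact ⟨hp, hx⟩
    · rintro ⟨hp, hx⟩
      exact ⟨_, hx, hp, rfl⟩
  · intro x _ y _ hxy
    apply Finset.disjoint_filter.2
    rintro s _ rfl h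
    exact hxy h

theorem sum_diffRep_le (A S : Finset G) : ∑ x ∈ S, diffRep A A x ≤ #A ^ 2 := by
  rw [sum_diffRep_eq_card, sq, ← Finset.card_product]
  exact Finset.card_filter_le _ _

/-- Sets with at most one element need separate treatment: there `Real.logb 2 #A` is 0, which would
make the logarithmic factor vanish. -/
theorem higherEnergy_le_of_card_le_one {A : Finset G} (hA : #A ≤ 1) {k : ℕ} {s : ℝ} :
    (higherEnergy k A : ℝ) ≤ (#A : ℝ) ^ s := by
  obtain h | h := Nat.le_one_iff_eq_zero_or_eq_one.1 hA
  · have : A = ∅ := Finset.card_eq_zero.1 h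
    subst this
    simp only [higherEnergy, Finset.empty_sub, Finset.sum_empty, Nat.cast_zero]
    positivity
  · obtain ⟨a, rfl⟩ := Finset.card_eq_one.1 h
    have h1 : higherEnergy k ({a} : Finset G) ≤ 1 := by
      simp only [higherEnergy, Finset.singleton_sub_singleton, Finset.sum_singleton]
      exact pow_le_one₀ (Nat.zero_le _) ((diffRep_le_card _ _ _).trans (by simp))
    simpa using h1

/-- The differences whose number of representations is at least `t`. -/
noncomputable def popularDiffs (A : Finset G) (t : ℝ) : Finset G :=
  {x ∈ A - A | t ≤ (diffRep A A x : ℝ)}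

theorem le_diffRep_of_mem_popularDiffs {A : Finset G} {t : ℝ} {x : G}
    (hx : x ∈ popularDiffs A t) : t ≤ (diffRep A A x : ℝ) := (Finset.mem_filter.1 hx).2

theorem mem_popularDiffs {A : Finset G} {t : ℝ} (ht : 0 < t) {x : G} :
    x ∈ popularDiffs A t ↔ t ≤ (diffRep A A x : ℝ) := by
  refine ⟨le_diffRep_of_mem_popularDiffs, fun h => Finset.mem_filter.2 ⟨?_, h⟩⟩
  have h0 : 0 < diffRep A A x := by exact_mod_cast ht.trans_le h
  obtain ⟨p, hp⟩ := Finset.card_pos.1 h0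
  obtain ⟨hp1, rfl⟩ := Finset.mem_filter.1 hp
  exact Finset.sub_mem_sub (Finset.mem_product.1 hp1).1 (Finset.mem_product.1 hp1).2

theorem mul_card_popularDiffs_le (A : Finset G) (t : ℝ) :
    t * #(popularDiffs A t) ≤ (#A : ℝ) ^ 2 := by
  have h1 : ∑ x ∈ popularDiffs A t, t ≤ ∑ x ∈ popularDiffs A t, (diffRep A A x : ℝ) :=
    Finset.sum_le_sum fun x hx => le_diffRep_of_mem_popularDiffs hx
  have h2 : ∑ x ∈ popularDiffs A t, (diffRep A A x : ℝ) ≤ (#A : ℝ) ^ 2 := by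
    exact_mod_cast sum_diffRep_le A (popularDiffs A t)
  rw [Finset.sum_const, nsmul_eq_mul, mul_comm] at h1
  exact h1.trans h2

/-- The differences that are not `t`-popular contribute at most `t ^ m * |A| ^ 2` to `E_{m + 1}(A)`. -/
theorem higherEnergy_le_sum_popularDiffs_add (A : Finset G) (m : ℕ) {t : ℝ} (ht : 0 ≤ t) :
    (higherEnergy (m + 1) A : ℝ) ≤
      (#A : ℝ) ^ m * ∑ x ∈ popularDiffs A t, (diffRep A A x : ℝ) + t ^ m * (#A : ℝ) ^ 2 := by
  unfold higherEnergy
  push_cast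
  rw [← Finset.sum_filter_add_sum_filter_not (A - A) (fun x => t ≤ (diffRep A A x : ℝ))]
  have hsplit : ∀ (S : Finset G) (u : ℝ), 0 ≤ u → (∀ x ∈ S, (diffRep A A x : ℝ) ≤ u) →
      ∑ x ∈ S, (diffRep A A x : ℝ) ^ (m + 1) ≤ u ^ m * ∑ x ∈ S, (diffRep A A x : ℝ) := by
    intro S u hu h
    rw [Finset.mul_sum]
    apply Finset.sum_le_sum
    intro x hx
    rw [pow_succ]
    gcongr
    exact h x hx
  refine add_le_add (hsplit _ _ (by positivity) ?_) ((hsplit _ t ht ?_).trans ?_)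
  · intro x _
    exact_mod_cast diffRep_le_card A A x
  · intro x hx
    exact (not_le.1 (Finset.mem_filter.1 hx).2).le
  · gcongr
    exact_mod_cast sum_diffRep_le A _

/-! ### Sets of popular differences: translates, subtraction, covering -/

/-- If all elements of `P` are popular differences of `A`, then many translates `a + P` with
`a ∈ A` meet `A` in a large set. -/
theorem le_card_filter_diffRep {A P : Finset G} (hP : P.Nonempty) {θ : ℝ}
    (hr : ∀ p ∈ P, θ * #A ≤ (diffRep A A p : ℝ)) (hθ : 0 ≤ θ) :
    θ / 2 * #A ≤ (#{a ∈ A | θ / 2 * #P ≤ (diffRep A P a : ℝ)} : ℝ) := by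
  have hsum : ∑ a ∈ A, diffRep A P a = ∑ p ∈ P, diffRep A A p := by
    have := Finset.sum_card_bipartiteAbove_eq_sum_card_bipartiteBelow
      (s := A) (t := P) (r := fun a p => a + p ∈ A)
    simp only [diffRep_eq_card_filter]
    convert this using 2 with p hp
    · rfl
    · exact congrArg Finset.card (Finset.filter_congr fun a _ => by rw [add_comm])
  have hsum' : ∑ a ∈ A, (diffRep A P a : ℝ) = ∑ p ∈ P, (diffRep A A p : ℝ) := by
    exact_mod_cast hsum
  have h1 : #P * (θ * #A) ≤ ∑ a ∈ A, (diffRep A P a : ℝ) := by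
    rw [hsum', ← nsmul_eq_mul, ← Finset.sum_const]
    exact Finset.sum_le_sum hr
  have hP0 : (0 : ℝ) < #P := by exact_mod_cast hP.card_pos
  rw [← Finset.sum_filter_add_sum_filter_not A (fun a => θ / 2 * #P ≤ (diffRep A P a : ℝ))] at h1
  set B := {a ∈ A | θ / 2 * #P ≤ (diffRep A P a : ℝ)}
  have h2 : ∑ a ∈ B, (diffRep A P a : ℝ) ≤ #B * #P := by
    rw [← nsmul_eq_mul, ← Finset.sum_const]
    exact Finset.sum_le_sum fun a _ => by exact_mod_cast diffRep_le_card A P a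
  have h3 : ∑ a ∈ A with ¬ θ / 2 * #P ≤ (diffRep A P a : ℝ), (diffRep A P a : ℝ) ≤
      #A * (θ / 2 * #P) := by
    calc _ ≤ ∑ a ∈ A with ¬ θ / 2 * #P ≤ (diffRep A P a : ℝ), θ / 2 * #P :=
          Finset.sum_le_sum fun a ha => (not_le.1 (Finset.mem_filter.1 ha).2).le
      _ ≤ ∑ a ∈ A, θ / 2 * #P := by
          apply Finset.sum_le_sum_of_subset_of_nonneg (Finset.filter_subset _ _)
          intros; positivity
      _ = _ := by rw [Finset.sum_const, nsmul_eq_mul]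
  have h4 : θ / 2 * #A * #P ≤ #B * #P := by linarith
  exact le_of_mul_le_mul_right h4 hP0

/-- Each common a yields the representation p - q = (p + a) - (q + a). -/
theorem card_inter_le_diffRep_sub (A : Finset G) (p q : G) :
    #{a ∈ A | p + a ∈ A ∧ q + a ∈ A} ≤ diffRep A A (p - q) := by
  rw [diffRep_eq_card_filter]
  apply Finset.card_le_card_of_injOn (fun a => q + a)
  · intro a ha
    simp only [Finset.coe_filter, Set.mem_ofPred_eq] at ha ⊢
    exact ⟨ha.2.2, by rw [← add_assoc, sub_add_cancel]; exact ha.2.1⟩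
  · intro a _ b _ h
    exact add_left_cancel h

/-- Differences of popular differences are often popular. -/
theorem le_card_filter_sub_popular {A P : Finset G} (hA : A.Nonempty) {θ : ℝ}
    (hθ : 0 < θ) (hθ1 : θ ≤ 1) (hr : ∀ p ∈ P, θ * #A ≤ (diffRep A A p : ℝ)) :
    θ ^ 2 / 3 * (#P : ℝ) ^ 2 ≤
      (#{p ∈ P ×ˢ P | p.1 - p.2 ∈ popularDiffs A (θ ^ 3 * #A)} : ℝ) := by
  have hn : (0 : ℝ) < #A := by exact_mod_cast hA.card_pos
  simp only [mem_popularDiffs (show 0 < θ ^ 3 * (#A : ℝ) by positivity)]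
  -- The averaging argument below only gives the proportion θ² - θ³, which degenerates as θ → 1. For
  -- θ ≥ 2/3 inclusion–exclusion makes every pair good, because 2θ - 1 ≥ θ³.
  obtain h | h := le_or_gt (2 / 3) θ
  · have hall : ({p ∈ P ×ˢ P | θ ^ 3 * #A ≤ (diffRep A A (p.1 - p.2) : ℝ)} : Finset (G × G)) =
        P ×ˢ P := by
      apply Finset.filter_true_of_mem
      rintro ⟨p, q⟩ hpq
      obtain ⟨hp, hq⟩ := Finset.mem_product.1 hpq
      have h1 := hr p hp
      have h2 := hr q hq
      rw [diffRep_eq_card_filter] at h1 h2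
      have h3 : (#{a ∈ A | p + a ∈ A ∧ q + a ∈ A} : ℝ) ≤ diffRep A A (p - q) := by
        exact_mod_cast card_inter_le_diffRep_sub A p q
      have h4 : #{a ∈ A | p + a ∈ A} + #{a ∈ A | q + a ∈ A} ≤
          #A + #{a ∈ A | p + a ∈ A ∧ q + a ∈ A} := by
        rw [← Finset.card_union_add_card_inter, ← Finset.filter_and]
        gcongr
        exact Finset.union_subset (Finset.filter_subset _ _) (Finset.filter_subset _ _)
      have h4' : (#{a ∈ A | p + a ∈ A} : ℝ) + #{a ∈ A | q + a ∈ A} ≤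
          #A + #{a ∈ A | p + a ∈ A ∧ q + a ∈ A} := by exact_mod_cast h4
      have h5 : θ ^ 3 ≤ 2 * θ - 1 := by
        have : 0 ≤ (1 - θ) * (θ ^ 2 + θ - 1) := mul_nonneg (by linarith) (by nlinarith)
        nlinarith
      have h6 : θ ^ 3 * (#A : ℝ) ≤ (2 * θ - 1) * #A := by gcongr
      show θ ^ 3 * (#A : ℝ) ≤ (diffRep A A (p - q) : ℝ)
      linarith
    rw [hall, Finset.card_product]
    push_cast
    rw [← sq]
    apply mul_le_of_le_one_left (by positivity)
    nlinarith
  · have hsum : ∑ a ∈ A, (#{p ∈ P | p + a ∈ A} : ℝ) = ∑ p ∈ P, (diffRep A A p : ℝ) := by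
      have := Finset.sum_card_bipartiteAbove_eq_sum_card_bipartiteBelow
        (s := A) (t := P) (r := fun a p => p + a ∈ A)
      simp only [diffRep_eq_card_filter]
      exact_mod_cast this
    have hsum2 : ∑ a ∈ A, (#{p ∈ P | p + a ∈ A} : ℝ) ^ 2 ≤
        ∑ p ∈ P ×ˢ P, (diffRep A A (p.1 - p.2) : ℝ) := by
      have := Finset.sum_card_bipartiteAbove_eq_sum_card_bipartiteBelow
        (s := A) (t := P ×ˢ P) (r := fun a p => p.1 + a ∈ A ∧ p.2 + a ∈ A)
      have h1 : ∑ a ∈ A, #{p ∈ P | p + a ∈ A} ^ 2 =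
          ∑ p ∈ P ×ˢ P, #{a ∈ A | p.1 + a ∈ A ∧ p.2 + a ∈ A} := by
        refine Eq.trans (Finset.sum_congr rfl fun a _ => ?_) this
        rw [sq, ← Finset.card_product]
        congr 1
        ext p
        simp only [Finset.mem_filter, Finset.mem_product, Finset.bipartiteAbove]
        tauto
      have h2 : ∑ a ∈ A, #{p ∈ P | p + a ∈ A} ^ 2 ≤
          ∑ p ∈ P ×ˢ P, diffRep A A (p.1 - p.2) :=
        h1.le.trans (Finset.sum_le_sum fun p _ => card_inter_le_diffRep_sub A p.1 p.2)
      exact_mod_cast h2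
    have hlow : #P * (θ * #A) ≤ ∑ p ∈ P, (diffRep A A p : ℝ) := by
      rw [← nsmul_eq_mul, ← Finset.sum_const]
      exact Finset.sum_le_sum hr
    have hcs := sq_sum_le_card_mul_sum_sq (s := A) (f := fun a => (#{p ∈ P | p + a ∈ A} : ℝ))
    rw [hsum] at hcs
    have h1 : (θ ^ 2 * #P ^ 2 * #A : ℝ) ≤ ∑ p ∈ P ×ˢ P, (diffRep A A (p.1 - p.2) : ℝ) := by
      refine le_trans ?_ hsum2
      apply le_of_mul_le_mul_left _ hn
      refine le_trans ?_ hcs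
      calc _ = (#P * (θ * #A) : ℝ) ^ 2 := by ring
        _ ≤ _ := by gcongr
    rw [← Finset.sum_filter_add_sum_filter_not (P ×ˢ P)
      (fun p => θ ^ 3 * #A ≤ (diffRep A A (p.1 - p.2) : ℝ))] at h1
    set B := {p ∈ P ×ˢ P | θ ^ 3 * #A ≤ (diffRep A A (p.1 - p.2) : ℝ)}
    have h2 : ∑ p ∈ B, (diffRep A A (p.1 - p.2) : ℝ) ≤ #B * #A := by
      rw [← nsmul_eq_mul, ← Finset.sum_const]
      exact Finset.sum_le_sum fun a _ => by exact_mod_cast diffRep_le_card A A _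
    have h3 : ∑ p ∈ P ×ˢ P with ¬ θ ^ 3 * #A ≤ (diffRep A A (p.1 - p.2) : ℝ),
        (diffRep A A (p.1 - p.2) : ℝ) ≤ #P ^ 2 * (θ ^ 3 * #A) := by
      calc _ ≤ ∑ p ∈ P ×ˢ P with ¬ θ ^ 3 * #A ≤ (diffRep A A (p.1 - p.2) : ℝ), θ ^ 3 * #A :=
            Finset.sum_le_sum fun a ha => (not_le.1 (Finset.mem_filter.1 ha).2).le
        _ ≤ ∑ p ∈ P ×ˢ P, θ ^ 3 * (#A : ℝ) := by
            apply Finset.sum_le_sum_of_subset_of_nonneg (Finset.filter_subset _ _)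
            intros; positivity
        _ = _ := by rw [Finset.sum_const, nsmul_eq_mul, Finset.card_product]; push_cast; ring
    have h4 : (θ ^ 2 - θ ^ 3) * (#P : ℝ) ^ 2 * #A ≤ #B * #A := by linarith
    have h5 := le_of_mul_le_mul_right h4 hn
    refine le_trans ?_ h5
    gcongr
    nlinarith [sq_nonneg θ]

/-- A set of small doubling consisting of popular differences of `A` has disjoint translates that
cover a large part of `A`. -/
theorem exists_isDirectSumset {A H : Finset G} (hH : H.Nonempty) {θ D : ℝ}
    (hθ : 0 < θ) (hr : ∀ p ∈ H, θ * #A ≤ (diffRep A A p : ℝ)) (hD : (#(H - H) : ℝ) ≤ D * #H) :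
    ∃ Z : Finset G, IsDirectSumset H Z ∧ (#Z : ℝ) * #H ≤ 2 / θ * #A ∧
      θ ^ 2 / (4 * D) * #A ≤ (#((H + Z) ∩ A) : ℝ) := by
  classical
  have hH0 : (0 : ℝ) < #H := by exact_mod_cast hH.card_pos
  have hD0 : 0 < D := by
    have : (0 : ℝ) < #(H - H) := by exact_mod_cast (hH.sub hH).card_pos
    by_contra! h
    nlinarith
  set B : Finset G := {a ∈ A | θ / 2 * #H ≤ (diffRep A H a : ℝ)} with hB
  have hBcard : θ / 2 * #A ≤ (#B : ℝ) := le_card_filter_diffRep hH hr hθ.le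
  -- A maximal family of disjoint translates z + H with z in B. Disjointness makes the sum direct;
  -- maximality makes every b + H meet some z + H, so B ⊆ Z + (H - H).
  obtain ⟨Z, hZ, hZmax⟩ := Finset.exists_maximal (s := B.powerset.filter fun Z : Finset G =>
    (Z : Set G).PairwiseDisjoint fun z => z +ᵥ H) ⟨∅, by simp⟩
  obtain ⟨hZB, hZd⟩ := Finset.mem_filter.1 hZ
  rw [Finset.mem_powerset] at hZB
  have hun : H + Z = Z.biUnion fun z => z +ᵥ H := by
    rw [add_comm]
    exact (Finset.biUnion_vadd_finset Z H).symm
  have hdirect : IsDirectSumset H Z := by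
    unfold IsDirectSumset
    rw [hun, Finset.card_biUnion hZd]
    simp [mul_comm]
  have hinter : (#Z : ℝ) * (θ / 2 * #H) ≤ #((H + Z) ∩ A) := by
    rw [hun, Finset.biUnion_inter, Finset.card_biUnion]
    · push_cast
      rw [← nsmul_eq_mul, ← Finset.sum_const]
      apply Finset.sum_le_sum
      intro z hz
      refine (Finset.mem_filter.1 (hZB hz)).2.trans ?_
      rw [diffRep_eq_card_filter]
      norm_cast
      apply Finset.card_le_card_of_injOn (fun h => z + h)
      · intro h hh
        simp only [Finset.coe_filter, Set.mem_ofPred_eq] at hh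
        simp only [Finset.coe_inter, Set.mem_inter_iff, Finset.mem_coe]
        exact ⟨Finset.vadd_mem_vadd_finset hh.1, hh.2⟩
      · intro a _ b _ h
        exact add_left_cancel h
    · intro z hz w hw hzw
      exact (hZd hz hw hzw).mono Finset.inter_subset_left Finset.inter_subset_left
  have hcover : B ⊆ Z + (H - H) := by
    intro b hb
    by_contra hnot
    have hbZ : b ∉ Z := fun hbZ => hnot (by
      obtain ⟨h, hh⟩ := hH
      have := Finset.add_mem_add hbZ (Finset.sub_mem_sub hh hh)
      simpa using this)
    have hins : insert b Z ∈ B.powerset.filter fun Z : Finset G =>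
        (Z : Set G).PairwiseDisjoint fun z => z +ᵥ H := by
      refine Finset.mem_filter.2 ⟨Finset.mem_powerset.2 (Finset.insert_subset hb hZB), ?_⟩
      rw [Finset.coe_insert]
      refine hZd.insert fun z hz _ => Finset.disjoint_left.2 ?_
      intro x hx hx'
      obtain ⟨h, hh, rfl⟩ := Finset.mem_vadd_finset.1 hx
      obtain ⟨h', hh', e⟩ := Finset.mem_vadd_finset.1 hx'
      apply hnot
      have : b = z + (h' - h) := by
        simp only [vadd_eq_add] at e
        rw [← add_sub_assoc, e]; abel
      rw [this]
      exact Finset.add_mem_add hz (Finset.sub_mem_sub hh' hh)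
    exact hbZ (hZmax hins (Finset.subset_insert _ _) (Finset.mem_insert_self _ _))
  have hBZ : (#B : ℝ) ≤ #Z * (D * #H) := by
    have : (#B : ℝ) ≤ #Z * #(H - H) := by
      exact_mod_cast (Finset.card_le_card hcover).trans Finset.card_add_le
    refine this.trans ?_
    gcongr
  refine ⟨Z, hdirect, ?_, ?_⟩
  · have h : (#((H + Z) ∩ A) : ℝ) ≤ #A := by
      exact_mod_cast Finset.card_le_card Finset.inter_subset_right
    rw [div_mul_eq_mul_div, le_div_iff₀ hθ]
    linarith
  · rw [div_mul_eq_mul_div, div_le_iff₀ (by positivity)]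
    have h1 := mul_le_mul_of_nonneg_left (hBcard.trans hBZ) (show 0 ≤ 2 * θ by positivity)
    have h2 := mul_le_mul_of_nonneg_right hinter (show 0 ≤ 4 * D by positivity)
    linarith

/-! ### Real-variable estimates -/

theorem exp_half_le_one_add {x : ℝ} (hx : 0 ≤ x) (hx1 : x ≤ 1) : Real.exp (x / 2) ≤ 1 + x := by
  have h := Real.add_one_le_exp (-(x / 2))
  have h2 : Real.exp (x / 2) * Real.exp (-(x / 2)) = 1 := by rw [← Real.exp_add]; simp
  have h3 := Real.exp_pos (x / 2)
  have h4 : Real.exp (x / 2) * (1 - x / 2) ≤ 1 := by rw [← h2]; gcongr; linarith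
  nlinarith

/-- A sequence that grows polynomially at each step is eventually a large power of its start. -/
theorem rpow_pow_lt_of_growth {f : ℕ → ℝ} {X c : ℝ} (hX : 0 < X) (hc : 0 ≤ c) (hc1 : c ≤ 1)
    (h0 : X / 2 ≤ f 0) {J : ℕ} (h : ∀ j < J + 1, 16 * f j ^ (1 + c) < f (j + 1)) :
    4 * X ^ ((1 + c) ^ (J + 1)) < f (J + 1) := by
  -- Halving the base costs a factor of at most 2^(1+c) ≤ 4, so the 16 leaves a spare factor 4,
  -- which later contradicts the upper bound for the last set.
  have hstep : ∀ j < J + 1, X ^ ((1 + c) ^ j) / 2 ≤ f j →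
      4 * X ^ ((1 + c) ^ (j + 1)) < f (j + 1) := by
    intro j hj hf
    refine lt_of_le_of_lt ?_ (h j hj)
    have hpos : 0 < X ^ ((1 + c) ^ j) := by positivity
    have h1 : (X ^ ((1 + c) ^ j) / 2) ^ (1 + c) ≤ f j ^ (1 + c) := by gcongr
    have h2 : (X ^ ((1 + c) ^ j) / 2) ^ (1 + c) = X ^ ((1 + c) ^ (j + 1)) / 2 ^ (1 + c) := by
      rw [Real.div_rpow hpos.le (by norm_num), ← Real.rpow_mul hX.le, pow_succ]
    have h3 : (2 : ℝ) ^ (1 + c) ≤ 4 := by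
      calc (2 : ℝ) ^ (1 + c) ≤ 2 ^ (2 : ℝ) := by gcongr <;> linarith
        _ = 4 := by norm_num
    have h4 : X ^ ((1 + c) ^ (j + 1)) / 4 ≤ X ^ ((1 + c) ^ (j + 1)) / 2 ^ (1 + c) := by gcongr
    linarith
  have hall : ∀ j < J + 1, X ^ ((1 + c) ^ j) / 2 ≤ f j := by
    intro j
    induction j with
    | zero => intro _; simpa using h0
    | succ j ih =>
      intro hj
      have h1 := hstep j (by omega) (ih (by omega))
      have : 0 < X ^ ((1 + c) ^ (j + 1)) := by positivity
      linarith
  exact hstep J (by omega) (hall J (by omega))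

/-- With L = ε⁻¹ log(1/δ), multiply 1 - δ ≤ εL ≤ ε e^L by 1 = δ e^(εL) ≤ δ e^L. This is what allows
M to be of order e^(2L). -/
theorem one_sub_le_mul_exp {ε δ : ℝ} (hε : 0 < ε) (hε1 : ε ≤ 1) (hδ : 0 < δ) (hδ1 : δ ≤ 1) :
    1 - δ ≤ δ * ε * Real.exp (2 * (ε⁻¹ * Real.log (1 / δ))) := by
  set L := ε⁻¹ * Real.log (1 / δ) with hL
  have hlog : 0 ≤ Real.log (1 / δ) := Real.log_nonneg (by rw [le_div_iff₀ hδ]; linarith)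
  have hL0 : 0 ≤ L := by positivity
  have hLε : ε * L = Real.log (1 / δ) := by rw [hL]; field_simp
  have hexp : δ * Real.exp (ε * L) = 1 := by
    rw [hLε, Real.exp_log (by positivity)]; field_simp
  have h1 : 1 - δ ≤ ε * L := by
    have := Real.add_one_le_exp (-(ε * L))
    have h2 : Real.exp (-(ε * L)) = δ := by
      rw [hLε, Real.exp_neg, Real.exp_log (by positivity)]; simp
    linarith
  have h2 : L ≤ Real.exp L := by linarith [Real.add_one_le_exp L]
  have h3 : Real.exp (ε * L) ≤ Real.exp L := by
    gcongr; nlinarith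
  calc 1 - δ ≤ ε * L * 1 := by linarith
    _ = ε * L * (δ * Real.exp (ε * L)) := by rw [hexp]
    _ ≤ ε * Real.exp L * (δ * Real.exp L) := by gcongr
    _ = _ := by rw [two_mul, Real.exp_add]; ring

/-! ### From large energy to popular differences -/

/-- Large higher energy yields many popular differences. -/
theorem le_sum_popularDiffs_of_lt_higherEnergy {A : Finset G} (hA : A.Nonempty) {m : ℕ} {δ θ : ℝ}
    (hθ : 0 ≤ θ) (hθm : θ ^ m = (#A : ℝ) ^ (δ - 1) / 2)
    (hE : (#A : ℝ) ^ (((m + 1 : ℕ) : ℝ) + δ) < higherEnergy (m + 1) A) :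
    (#A : ℝ) ^ (1 + δ) / 2 ≤ ∑ x ∈ popularDiffs A (θ * #A), (diffRep A A x : ℝ) := by
  have hn : (0 : ℝ) < #A := by exact_mod_cast hA.card_pos
  have h := hE.trans_le (higherEnergy_le_sum_popularDiffs_add A m (t := θ * #A) (by positivity))
  have e1 : (#A : ℝ) ^ (((m + 1 : ℕ) : ℝ) + δ) = (#A : ℝ) ^ m * (#A : ℝ) ^ (1 + δ) := by
    rw [← Real.rpow_natCast, ← Real.rpow_add hn]; push_cast; ring_nf
  have e2 : (#A : ℝ) ^ (δ - 1) * (#A : ℝ) ^ 2 = (#A : ℝ) ^ (1 + δ) := by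
    rw [← Real.rpow_natCast, ← Real.rpow_add hn]; push_cast; ring_nf
  have hm : 0 < (#A : ℝ) ^ m := by positivity
  rw [e1, mul_pow, hθm] at h
  apply le_of_mul_le_mul_left _ hm
  have e3 : (#A : ℝ) ^ (δ - 1) / 2 * (#A : ℝ) ^ m * (#A : ℝ) ^ 2 =
      (#A : ℝ) ^ m * (#A : ℝ) ^ (1 + δ) / 2 := by rw [← e2]; ring
  rw [e3] at h
  linarith

theorem le_card_popularDiffs_of_lt_higherEnergy {A : Finset G} (hA : A.Nonempty) {m : ℕ} {δ θ : ℝ}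
    (hθ : 0 ≤ θ) (hθm : θ ^ m = (#A : ℝ) ^ (δ - 1) / 2)
    (hE : (#A : ℝ) ^ (((m + 1 : ℕ) : ℝ) + δ) < higherEnergy (m + 1) A) :
    (#A : ℝ) ^ δ / 2 ≤ #(popularDiffs A (θ * #A)) := by
  have hn : (0 : ℝ) < #A := by exact_mod_cast hA.card_pos
  have h := le_sum_popularDiffs_of_lt_higherEnergy hA hθ hθm hE
  have h2 : ∑ x ∈ popularDiffs A (θ * #A), (diffRep A A x : ℝ) ≤
      #(popularDiffs A (θ * #A)) * #A := by
    rw [← nsmul_eq_mul, ← Finset.sum_const]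
    exact Finset.sum_le_sum fun a _ => by exact_mod_cast diffRep_le_card A A _
  rw [Real.rpow_add hn, Real.rpow_one] at h
  apply le_of_mul_le_mul_right _ hn
  linarith

/-- A root of `n ^ (δ - 1) / 2`, none of whose moderate powers is much smaller than `1`. -/
theorem exists_root_rpow {n δ : ℝ} (hn : 1 ≤ n) (hδ : δ ≤ 1) {m : ℕ} (hm : 0 < m) :
    ∃ θ : ℝ, 0 < θ ∧ θ ≤ 1 ∧ θ ^ m = n ^ (δ - 1) / 2 ∧
      ∀ (q : ℕ) (γ : ℝ), q ≤ m → (1 - δ) * q ≤ γ * m → n ^ (-γ) / 2 ≤ θ ^ q := by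
  have hn0 : 0 < n := by linarith
  have hm0 : (0 : ℝ) < m := by exact_mod_cast hm
  have hb : 0 < n ^ (δ - 1) / 2 := by positivity
  have hb1 : n ^ (δ - 1) / 2 ≤ 1 := by
    have := Real.rpow_le_one_of_one_le_of_nonpos hn (show δ - 1 ≤ 0 by linarith)
    linarith
  refine ⟨(n ^ (δ - 1) / 2) ^ ((m : ℝ)⁻¹), by positivity,
    Real.rpow_le_one hb.le hb1 (by positivity), Real.rpow_inv_natCast_pow hb.le hm.ne', ?_⟩
  intro q γ hq hγ
  rw [← Real.rpow_natCast, ← Real.rpow_mul hb.le, Real.div_rpow (by positivity) (by norm_num),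
    ← Real.rpow_mul hn0.le]
  have hq' : (m : ℝ)⁻¹ * q ≤ 1 := by
    rw [inv_mul_le_iff₀ hm0, mul_one]; exact_mod_cast hq
  have h2 : (2 : ℝ) ^ ((m : ℝ)⁻¹ * q) ≤ 2 := by
    calc (2 : ℝ) ^ ((m : ℝ)⁻¹ * q) ≤ 2 ^ (1 : ℝ) := by gcongr; norm_num
      _ = 2 := by norm_num
  have h3 : -γ ≤ (δ - 1) * ((m : ℝ)⁻¹ * q) := by
    have : (1 - δ) * ((m : ℝ)⁻¹ * q) ≤ γ := by
      rw [← mul_assoc, mul_comm (1 - δ), mul_assoc, inv_mul_le_iff₀ hm0]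
      linarith
    linarith
  gcongr

/-- Large higher energy makes many elements of `A` popular with respect to a large set `P`. -/
theorem exists_popular_subset_of_lt_higherEnergy {A : Finset G} (hA : A.Nonempty) {m : ℕ}
    (hm : 0 < m) {ε δ : ℝ} (hδ0 : 0 ≤ δ) (hδ : δ ≤ 1) (hεm : 1 ≤ ε * m)
    (hE : (#A : ℝ) ^ (((m + 1 : ℕ) : ℝ) + δ) < higherEnergy (m + 1) A) :
    ∃ A' P : Finset G, A' ⊆ A ∧ (#A : ℝ) ^ (1 - ε) ≤ 4 * #A' ∧ (#A : ℝ) ^ δ ≤ 2 * #P ∧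
      ∀ x ∈ A', (#P : ℝ) * (#A : ℝ) ^ (-ε) ≤ 4 * (diffRep A P x : ℝ) := by
  have hn : (1 : ℝ) ≤ #A := by exact_mod_cast hA.card_pos
  have hn0 : (0 : ℝ) < #A := by linarith
  obtain ⟨θ, hθ, -, hθm, hpow⟩ := exists_root_rpow hn hδ hm
  have hθε : (#A : ℝ) ^ (-ε) / 2 ≤ θ := by
    simpa using hpow 1 ε hm (by push_cast; linarith)
  have hP := le_card_popularDiffs_of_lt_higherEnergy hA hθ.le hθm hE
  set P := popularDiffs A (θ * #A) with hPdef
  have hP0 : P.Nonempty := by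
    have : (0 : ℝ) < #P := lt_of_lt_of_le (by positivity) hP
    exact Finset.card_pos.1 (by exact_mod_cast this)
  refine ⟨{a ∈ A | θ / 2 * #P ≤ (diffRep A P a : ℝ)}, P, Finset.filter_subset _ _, ?_,
    by linarith, ?_⟩
  · have h := le_card_filter_diffRep hP0 (fun p hp => le_diffRep_of_mem_popularDiffs hp) hθ.le
    have e : (#A : ℝ) ^ (1 - ε) = (#A : ℝ) ^ (-ε) * #A := by
      rw [sub_eq_neg_add, Real.rpow_add hn0, Real.rpow_one]
    rw [e]
    nlinarith
  · intro x hx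
    have h := (Finset.mem_filter.1 hx).2
    have : (#A : ℝ) ^ (-ε) / 2 * #P ≤ θ * #P := by gcongr
    linarith

/-- Very large additive energy yields a large subset of small doubling. -/
theorem exists_small_doubling_subset_of_lt_higherEnergy {A : Finset G} (hA : A.Nonempty)
    {ε δ C : ℝ} (hε : 0 < ε) (hεδ : ε ≤ δ) (hclose : 20 * (1 - δ) ≤ ε)
    (hC : 2 ^ 110 ≤ C) (hE : (#A : ℝ) ^ (((2 : ℕ) : ℝ) + δ) < higherEnergy 2 A) :
    ∃ H Z : Finset G, (#A : ℝ) ^ (δ * (1 - ε)) ≤ C * (#H : ℝ) ∧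
      (#(H + H) : ℝ) ≤ C * (#A : ℝ) ^ ε * (#H : ℝ) ∧
      (#Z : ℝ) * (#H : ℝ) ≤ C * (#A : ℝ) ^ (1 + ε) ∧ IsDirectSumset H Z ∧
      (#A : ℝ) ^ (1 - ε) ≤ C * (#((H + Z) ∩ A) : ℝ) := by
  have hn : (1 : ℝ) ≤ #A := by exact_mod_cast hA.card_pos
  have hn0 : (0 : ℝ) < #A := by linarith
  have hC0 : (0 : ℝ) < C := by linarith [show (0 : ℝ) < 2 ^ 110 by positivity]
  set θ := (#A : ℝ) ^ (δ - 1) / 2 with hθdef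
  have hθ : 0 < θ := by positivity
  have hsum := le_sum_popularDiffs_of_lt_higherEnergy hA (m := 1) hθ.le (by rw [pow_one]) hE
  set S := popularDiffs A (θ * #A) with hSdef
  have e1 : (#A : ℝ) ^ (1 + δ) = (#A : ℝ) ^ (δ - 1) * (#A : ℝ) ^ 2 := by
    rw [← Real.rpow_natCast, ← Real.rpow_add hn0]; push_cast; ring_nf
  have hpairs : θ * (#A : ℝ) ^ 2 ≤ #{p ∈ A ×ˢ A | p.1 - p.2 ∈ S} := by
    have h := sum_diffRep_eq_card A S
    have h' : ∑ x ∈ S, (diffRep A A x : ℝ) = #{p ∈ A ×ˢ A | p.1 - p.2 ∈ S} := by exact_mod_cast h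
    rw [← h']
    refine le_trans (le_of_eq ?_) hsum
    rw [e1, hθdef]; ring
  have hScard : (#S : ℝ) ≤ θ⁻¹ * #A := by
    have h := mul_card_popularDiffs_le A (θ * #A)
    rw [inv_mul_eq_div, le_div_iff₀ hθ]
    apply le_of_mul_le_mul_right _ hn0
    linarith
  obtain ⟨H, hHA, hH, hHH⟩ := exists_subset_card_sub_le hA hθ hpairs hScard
  have hH0 : H.Nonempty := by
    have : (0 : ℝ) < #H := lt_of_lt_of_le (by positivity) hH
    exact Finset.card_pos.1 (by exact_mod_cast this)
  have hHpp := card_add_self_le_of_card_sub_self_le hH0 hHH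
  have hHn : (#H : ℝ) ≤ #A := by exact_mod_cast Finset.card_le_card hHA
  have hHδ : (#A : ℝ) ^ δ ≤ 8 * #H := by
    have : (#A : ℝ) ^ δ = (#A : ℝ) ^ (δ - 1) * #A := by
      rw [← Real.rpow_add_one hn0.ne']; ring_nf
    rw [this]
    have hH' := hH
    rw [hθdef] at hH'
    linarith
  have hC8 : 8 * (#H : ℝ) ≤ C * #H := by
    gcongr
    exact le_trans (by norm_num) hC
  refine ⟨H, {0}, ?_, ?_, ?_, ?_, ?_⟩
  · refine le_trans ?_ (hHδ.trans hC8)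
    exact Real.rpow_le_rpow_of_exponent_le hn (by nlinarith)
  · refine hHpp.trans ?_
    gcongr
    -- Density θ and K = θ⁻¹ cost θ⁻¹⁰ in the difference set, and Plünnecke squares this; hence the
    -- 20 in `hclose`.
    have e2 : (4096 * θ⁻¹ ^ 4 / θ ^ 6) ^ 2 = 2 ^ 44 * (#A : ℝ) ^ (20 * (1 - δ)) := by
      have h : (#A : ℝ) ^ (20 * (1 - δ)) = ((#A : ℝ) ^ (δ - 1))⁻¹ ^ 20 := by
        rw [← Real.rpow_neg hn0.le, ← Real.rpow_natCast, ← Real.rpow_mul hn0.le]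
        congr 1; push_cast; ring
      rw [h, hθdef]
      have : 0 < (#A : ℝ) ^ (δ - 1) := by positivity
      field_simp
      norm_num
    rw [e2]
    gcongr
    exact le_trans (by norm_num) hC
  · simp only [Finset.card_singleton, Nat.cast_one, one_mul]
    refine hHn.trans ?_
    have h1 : (#A : ℝ) ≤ (#A : ℝ) ^ (1 + ε) := by
      conv_lhs => rw [← Real.rpow_one (#A : ℝ)]
      exact Real.rpow_le_rpow_of_exponent_le hn (by linarith)
    have h2 : (1 : ℝ) ≤ C := le_trans (by norm_num) hC
    nlinarith [show 0 < (#A : ℝ) ^ (1 + ε) by positivity]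
  · simp [IsDirectSumset]
  · rw [Finset.singleton_zero, add_zero, Finset.inter_eq_left.2 hHA]
    refine le_trans ?_ (hHδ.trans hC8)
    exact Real.rpow_le_rpow_of_exponent_le hn (by linarith)

/-! ### Slow growth and the structure theorem -/

/-- Somewhere along the chain of sets of `θ ^ 3 ^ j`-popular differences the growth is slow. -/
theorem exists_slow_growth {A : Finset G} (hA : A.Nonempty) {ε δ γ θ : ℝ} (hε : 0 ≤ ε)
    (hε1 : ε ≤ 1) {J : ℕ} (hθ : 0 < θ) (h0 : (#A : ℝ) ^ δ / 2 ≤ #(popularDiffs A (θ * #A)))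
    (hJ : 1 + γ ≤ δ * (1 + ε / 32) ^ (J + 1)) (hθJ : (#A : ℝ) ^ (-γ) / 2 ≤ θ ^ 3 ^ (J + 1)) :
    ∃ j < J + 1, (#(popularDiffs A (θ ^ 3 ^ (j + 1) * #A)) : ℝ) ≤
      16 * (#(popularDiffs A (θ ^ 3 ^ j * #A)) : ℝ) ^ (1 + ε / 32) := by
  have hn : (1 : ℝ) ≤ #A := by exact_mod_cast hA.card_pos
  have hn0 : (0 : ℝ) < #A := by linarith
  by_contra! hgrow
  have h := rpow_pow_lt_of_growth (f := fun j => (#(popularDiffs A (θ ^ 3 ^ j * #A)) : ℝ))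
    (X := (#A : ℝ) ^ δ) (by positivity) (by positivity) (by linarith : ε / 32 ≤ 1)
    (by simpa using h0) hgrow
  rw [← Real.rpow_mul hn0.le] at h
  have h1 : (#A : ℝ) ^ (1 + γ) ≤ (#A : ℝ) ^ (δ * (1 + ε / 32) ^ (J + 1)) :=
    Real.rpow_le_rpow_of_exponent_le hn hJ
  have h2 := mul_card_popularDiffs_le A (θ ^ 3 ^ (J + 1) * #A)
  have h3 : θ ^ 3 ^ (J + 1) * #(popularDiffs A (θ ^ 3 ^ (J + 1) * #A)) ≤ #A := by
    apply le_of_mul_le_mul_right _ hn0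
    linarith
  -- Constant growth would give the last set more than 4n^(1+γ) elements, while its popularity
  -- threshold allows at most 2n^(1+γ).
  have h4 : (#A : ℝ) ^ (-γ) / 2 * (4 * (#A : ℝ) ^ (1 + γ)) ≤ #A := by
    refine le_trans ?_ h3
    gcongr
    exact (mul_le_mul_of_nonneg_left h1 (by norm_num)).trans h.le
  have h5 : (#A : ℝ) ^ (-γ) / 2 * (4 * (#A : ℝ) ^ (1 + γ)) = 2 * #A := by
    have : (#A : ℝ) ^ (-γ) * (#A : ℝ) ^ (1 + γ) = #A := by
      rw [← Real.rpow_add hn0]; simp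
    linear_combination 2 * this
  linarith

/-- If the differences of the popular set `P` are contained in a set that is not much larger than
`P`, then `A` has large intersection with a direct sum of a set of small doubling. -/
theorem exists_structure_of_slow_growth {A : Finset G} (hA : A.Nonempty) {ε δ η C : ℝ}
    (hε : 0 < ε) (hε1 : ε ≤ 1) (hδ0 : 0 < δ) (hδ : δ ≤ 1) (hC : 2 ^ 110 ≤ C)
    (hη : 0 < η) (hη1 : η ≤ 1) (hηε : (#A : ℝ) ^ (-(δ * ε / 48)) / 2 ≤ η)
    (hP : (#A : ℝ) ^ δ / 2 ≤ #(popularDiffs A (η * #A)))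
    (hslow : (#(popularDiffs A (η ^ 3 * #A)) : ℝ) ≤
      16 * (#(popularDiffs A (η * #A)) : ℝ) ^ (1 + ε / 32)) :
    ∃ H Z : Finset G, (#A : ℝ) ^ (δ * (1 - ε)) ≤ C * (#H : ℝ) ∧
      (#(H + H) : ℝ) ≤ C * (#A : ℝ) ^ ε * (#H : ℝ) ∧
      (#Z : ℝ) * (#H : ℝ) ≤ C * (#A : ℝ) ^ (1 + ε) ∧ IsDirectSumset H Z ∧
      (#A : ℝ) ^ (1 - ε) ≤ C * (#((H + Z) ∩ A) : ℝ) := by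
  have hn : (1 : ℝ) ≤ #A := by exact_mod_cast hA.card_pos
  have hn0 : (0 : ℝ) < #A := by linarith
  have hC0 : (0 : ℝ) < C := lt_of_lt_of_le (by norm_num) hC
  set n : ℝ := (#A : ℝ) with hndef
  set P := popularDiffs A (η * n) with hPdef
  have hr : ∀ p ∈ P, η * n ≤ (diffRep A A p : ℝ) := fun p hp => le_diffRep_of_mem_popularDiffs hp
  have hPpos : (0 : ℝ) < #P := lt_of_lt_of_le (by positivity) hP
  have hPne : P.Nonempty := Finset.card_pos.1 (by exact_mod_cast hPpos)
  have hδε : δ * ε ≤ ε := by nlinarith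
  have hrpow : ∀ {s t : ℝ}, s ≤ t → n ^ s ≤ n ^ t := Real.rpow_le_rpow_of_exponent_le hn
  have hηinv : η⁻¹ ≤ 2 * n ^ (δ * ε / 48) := by
    rw [Real.rpow_neg hn0.le] at hηε
    have h := inv_anti₀ (by positivity) hηε
    rwa [inv_div, div_inv_eq_mul] at h
  have hηinv_pow : ∀ q : ℕ, η⁻¹ ^ q ≤ 2 ^ q * n ^ (q * (δ * ε / 48)) := by
    intro q
    have h : (n ^ (δ * ε / 48)) ^ q = n ^ (q * (δ * ε / 48)) := by
      rw [← Real.rpow_natCast, ← Real.rpow_mul hn0.le, mul_comm]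
    rw [← h, ← mul_pow]
    gcongr
  have hPn : (#P : ℝ) ≤ 2 * n ^ (2 : ℝ) := by
    have h1 := mul_card_popularDiffs_le A (η * n)
    have h2 : (#P : ℝ) ≤ η⁻¹ * n := by
      rw [inv_mul_eq_div, le_div_iff₀ hη]
      apply le_of_mul_le_mul_right _ hn0
      linarith
    have h3 : n ^ (δ * ε / 48) ≤ n ^ (1 : ℝ) := hrpow (by linarith)
    have h4 : n ^ (2 : ℝ) = n ^ (1 : ℝ) * n := by rw [Real.rpow_one, Real.rpow_two, sq]
    calc (#P : ℝ) ≤ η⁻¹ * n := h2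
      _ ≤ 2 * n ^ (1 : ℝ) * n := by gcongr; linarith
      _ = _ := by rw [h4]; ring
  have hslow' : (#(popularDiffs A (η ^ 3 * n)) : ℝ) ≤ 16 * (#P : ℝ) ^ (ε / 32) * #P := by
    refine hslow.trans (le_of_eq ?_)
    rw [Real.rpow_add hPpos, Real.rpow_one]; ring
  obtain ⟨H, hHP, hH, hHH⟩ := exists_subset_card_sub_le hPne (by positivity : 0 < η ^ 2 / 3)
    (le_card_filter_sub_popular hA hη hη1 hr) hslow'
  have hHpos : (0 : ℝ) < #H := lt_of_lt_of_le (by positivity) hH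
  have hHne : H.Nonempty := Finset.card_pos.1 (by exact_mod_cast hHpos)
  have hK : (16 * (#P : ℝ) ^ (ε / 32)) ^ 4 ≤ 2 ^ 17 * n ^ (ε / 4) := by
    have e : (16 * (#P : ℝ) ^ (ε / 32)) ^ 4 = 2 ^ 16 * (#P : ℝ) ^ (ε / 8) := by
      rw [mul_pow, ← Real.rpow_natCast (_ ^ (ε / 32)), ← Real.rpow_mul hPpos.le]
      norm_num; ring_nf
    rw [e]
    have h1 : (#P : ℝ) ^ (ε / 8) ≤ 2 * n ^ (ε / 4) := by
      calc (#P : ℝ) ^ (ε / 8) ≤ (2 * n ^ (2 : ℝ)) ^ (ε / 8) := by gcongr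
        _ = 2 ^ (ε / 8) * n ^ (ε / 4) := by
          rw [Real.mul_rpow (by norm_num) (by positivity), ← Real.rpow_mul hn0.le]
          ring_nf
        _ ≤ 2 ^ (1 : ℝ) * n ^ (ε / 4) := by
          gcongr
          · norm_num
          · linarith
        _ = _ := by norm_num
    linarith
  set D := 4096 * (16 * (#P : ℝ) ^ (ε / 32)) ^ 4 / (η ^ 2 / 3) ^ 6 with hDdef
  have hDpos : 0 < D := by positivity
  -- Exponent budget: K⁴ costs n^(ε/4) since |P| ≤ 2n² and K = 16|P|^(ε/32); the twelve factors η⁻¹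
  -- cost n^(12δε/48) ≤ n^(ε/4). Squaring in Plünnecke then gives n^ε.
  have hD : D ≤ 2 ^ 51 * n ^ (ε / 2) := by
    have e : D = 4096 * 729 * ((16 * (#P : ℝ) ^ (ε / 32)) ^ 4 * η⁻¹ ^ 12) := by
      rw [hDdef]; field_simp; norm_num
    have h1 := hηinv_pow 12
    have h2 : n ^ (((12 : ℕ) : ℝ) * (δ * ε / 48)) ≤ n ^ (ε / 4) := hrpow (by push_cast; linarith)
    have h3 : n ^ (ε / 2) = n ^ (ε / 4) * n ^ (ε / 4) := by
      rw [← Real.rpow_add hn0]; ring_nf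
    rw [e, h3]
    calc 4096 * 729 * ((16 * (#P : ℝ) ^ (ε / 32)) ^ 4 * η⁻¹ ^ 12)
        ≤ 4096 * 729 * ((2 ^ 17 * n ^ (ε / 4)) * (2 ^ 12 * n ^ (ε / 4))) := by
          gcongr
          exact h1.trans (by gcongr)
      _ = (4096 * 729 * 2 ^ 29) * (n ^ (ε / 4) * n ^ (ε / 4)) := by ring
      _ ≤ _ := by gcongr; norm_num
  obtain ⟨Z, hdirect, hZ, hinter⟩ :=
    exists_isDirectSumset hHne hη (fun p hp => hr p (hHP hp)) hHH
  refine ⟨H, Z, ?_, ?_, ?_, hdirect, ?_⟩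
  · have h1 : η⁻¹ ^ 2 ≤ 4 * n ^ (δ * ε) := by
      refine (hηinv_pow 2).trans ?_
      have : n ^ (((2 : ℕ) : ℝ) * (δ * ε / 48)) ≤ n ^ (δ * ε) :=
        hrpow (by push_cast; nlinarith [mul_pos hδ0 hε])
      norm_num at this ⊢
      linarith
    have h2 : n ^ δ ≤ 24 * #H * η⁻¹ ^ 2 := by
      have h3 : η ^ 2 * n ^ δ ≤ 24 * #H := by nlinarith [sq_nonneg η]
      rw [inv_pow, ← div_eq_mul_inv, le_div_iff₀ (by positivity)]
      linarith
    have h3 : n ^ δ = n ^ (δ * (1 - ε)) * n ^ (δ * ε) := by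
      rw [← Real.rpow_add hn0]; ring_nf
    have h4 : n ^ (δ * (1 - ε)) * n ^ (δ * ε) ≤ 96 * #H * n ^ (δ * ε) := by
      rw [← h3]
      refine h2.trans ?_
      calc 24 * (#H : ℝ) * η⁻¹ ^ 2 ≤ 24 * #H * (4 * n ^ (δ * ε)) := by gcongr
        _ = _ := by ring
    refine (le_of_mul_le_mul_right h4 (by positivity)).trans ?_
    gcongr
    exact le_trans (by norm_num) hC
  · refine (card_add_self_le_of_card_sub_self_le hHne hHH).trans ?_
    gcongr
    have h3 : n ^ ε = n ^ (ε / 2) * n ^ (ε / 2) := by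
      rw [← Real.rpow_add hn0]; ring_nf
    calc D ^ 2 ≤ (2 ^ 51 * n ^ (ε / 2)) ^ 2 := by gcongr
      _ = 2 ^ 102 * n ^ ε := by rw [h3]; ring
      _ ≤ _ := by
        gcongr
        exact le_trans (by norm_num) hC
  · refine hZ.trans ?_
    have h1 : n ^ (δ * ε / 48) ≤ n ^ ε := hrpow (by linarith)
    rw [Real.rpow_add hn0, Real.rpow_one, div_eq_mul_inv]
    calc 2 * η⁻¹ * n ≤ 2 * (2 * n ^ ε) * n := by gcongr; linarith
      _ = 4 * (n * n ^ ε) := by ring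
      _ ≤ _ := by
        gcongr
        exact le_trans (by norm_num) hC
  · have h1 : η⁻¹ ^ 2 ≤ 4 * n ^ (ε / 2) := by
      refine (hηinv_pow 2).trans ?_
      have : n ^ (((2 : ℕ) : ℝ) * (δ * ε / 48)) ≤ n ^ (ε / 2) :=
        hrpow (by push_cast; linarith)
      norm_num at this ⊢
      linarith
    have h3 : n ^ ε = n ^ (ε / 2) * n ^ (ε / 2) := by
      rw [← Real.rpow_add hn0]; ring_nf
    have h4 : 4 * D * η⁻¹ ^ 2 ≤ C * n ^ ε := by
      calc 4 * D * η⁻¹ ^ 2 ≤ 4 * (2 ^ 51 * n ^ (ε / 2)) * (4 * n ^ (ε / 2)) := by gcongr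
        _ = 2 ^ 55 * n ^ ε := by rw [h3]; ring
        _ ≤ _ := by
          gcongr
          exact le_trans (by norm_num) hC
    have h5 : n ≤ 4 * D * η⁻¹ ^ 2 * #((H + Z) ∩ A) := by
      have := mul_le_mul_of_nonneg_left hinter (show 0 ≤ 4 * D * η⁻¹ ^ 2 by positivity)
      refine le_trans (le_of_eq ?_) this
      rw [← hndef]
      field_simp
    rw [Real.rpow_sub hn0, Real.rpow_one, div_le_iff₀ (by positivity)]
    calc n ≤ 4 * D * η⁻¹ ^ 2 * #((H + Z) ∩ A) := h5
      _ ≤ C * n ^ ε * #((H + Z) ∩ A) := by gcongr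
      _ = _ := by ring

/-- The structure theorem for sets with large higher energy `E_k`, with the parameters of the
argument explicit: `k - 1 = 3 ^ (J + 1) * M`. -/
theorem exists_structure_of_lt_higherEnergy {A : Finset G} (hA : A.Nonempty) {ε δ C : ℝ}
    (hε : 0 < ε) (hε1 : ε ≤ 1) (hδ0 : 0 < δ) (hδ : δ ≤ 1) (hC : 2 ^ 110 ≤ C) {J M : ℕ} (hM0 : 0 < M)
    (hM : 1 - δ ≤ δ * ε / 48 * M) (hJ : 1 + δ * ε / 48 ≤ δ * (1 + ε / 32) ^ (J + 1))
    (hE : (#A : ℝ) ^ (((3 ^ (J + 1) * M + 1 : ℕ) : ℝ) + δ) <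
      higherEnergy (3 ^ (J + 1) * M + 1) A) :
    ∃ H Z : Finset G, (#A : ℝ) ^ (δ * (1 - ε)) ≤ C * (#H : ℝ) ∧
      (#(H + H) : ℝ) ≤ C * (#A : ℝ) ^ ε * (#H : ℝ) ∧
      (#Z : ℝ) * (#H : ℝ) ≤ C * (#A : ℝ) ^ (1 + ε) ∧ IsDirectSumset H Z ∧
      (#A : ℝ) ^ (1 - ε) ≤ C * (#((H + Z) ∩ A) : ℝ) := by
  have hn : (1 : ℝ) ≤ #A := by exact_mod_cast hA.card_pos
  have hn0 : (0 : ℝ) < #A := by linarith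
  obtain ⟨θ, hθ, hθ1, hθm, hpow⟩ := exists_root_rpow hn hδ (show 0 < 3 ^ (J + 1) * M by positivity)
  have h0 := le_card_popularDiffs_of_lt_higherEnergy hA hθ.le hθm hE
  have hθJ : (#A : ℝ) ^ (-(δ * ε / 48)) / 2 ≤ θ ^ 3 ^ (J + 1) := by
    apply hpow _ _ (Nat.le_mul_of_pos_right _ hM0)
    push_cast
    have := mul_le_mul_of_nonneg_right hM (show (0 : ℝ) ≤ 3 ^ (J + 1) by positivity)
    linarith
  obtain ⟨j, hj, hslow⟩ := exists_slow_growth hA hε.le hε1 hθ h0 hJ hθJ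
  -- Lowering the threshold only enlarges the popular set, so the lower bound n^δ/2 passes from P_0
  -- to P_j.
  have hle : θ ^ 3 ^ j ≤ θ := by
    calc θ ^ 3 ^ j ≤ θ ^ 1 := pow_le_pow_of_le_one hθ.le hθ1 (Nat.one_le_pow _ _ (by norm_num))
      _ = θ := pow_one θ
  refine exists_structure_of_slow_growth hA hε hε1 hδ0 hδ hC (η := θ ^ 3 ^ j) (by positivity)
    (pow_le_one₀ hθ.le hθ1) ?_ ?_ ?_
  · refine hθJ.trans (pow_le_pow_of_le_one hθ.le hθ1 ?_)
    exact Nat.pow_le_pow_right (by norm_num) hj.le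
  · refine h0.trans ?_
    norm_cast
    apply Finset.card_le_card
    intro x hx
    obtain ⟨h1, h2⟩ := Finset.mem_filter.1 hx
    refine Finset.mem_filter.2 ⟨h1, le_trans ?_ h2⟩
    gcongr
  · rwa [← pow_mul, ← pow_succ]

/-! ### Choice of parameters and conclusion -/

/-- A choice of the parameters for `exists_structure_of_lt_higherEnergy`. -/
theorem exists_parameters {ε δ : ℝ} (hε : 0 < ε) (hε1 : ε ≤ 1) (hδ0 : 0 < δ) (hδ : δ ≤ 1)
    (hL : 1 / 20 ≤ ε⁻¹ * Real.log (1 / δ)) :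
    ∃ J M : ℕ, 0 < M ∧ 1 - δ ≤ δ * ε / 48 * M ∧ 1 + δ * ε / 48 ≤ δ * (1 + ε / 32) ^ (J + 1) ∧
      ((3 ^ (J + 1) * M + 1 : ℕ) : ℝ) ≤ Real.exp (1000 * (ε⁻¹ * Real.log (1 / δ))) := by
  have hM := one_sub_le_mul_exp hε hε1 hδ0 hδ
  set L := ε⁻¹ * Real.log (1 / δ) with hLdef
  have hLε : ε * L = Real.log (1 / δ) := by rw [hLdef]; field_simp
  have hL0 : 0 < L := by linarith
  have hMpos : 0 < ⌈48 * Real.exp (2 * L)⌉₊ := Nat.ceil_pos.2 (by positivity)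
  -- With 128L steps, (1 + ε/32)^(J+1) ≥ e^(2εL) = δ⁻², so the target exponent is at least δ⁻¹ ≥ 1 +
  -- εL. The bound L ≥ 1/20 gives the slack δε/48 here and absorbs the additive constants in the
  -- bound for k.
  refine ⟨⌈128 * L⌉₊, ⌈48 * Real.exp (2 * L)⌉₊, hMpos, ?_, ?_, ?_⟩
  · calc 1 - δ ≤ δ * ε / 48 * (48 * Real.exp (2 * L)) := by linarith
      _ ≤ _ := by
        gcongr
        exact Nat.le_ceil _
  · have h1 : Real.exp (2 * (ε * L)) ≤ (1 + ε / 32) ^ (⌈128 * L⌉₊ + 1) := by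
      calc Real.exp (2 * (ε * L)) ≤ Real.exp ((⌈128 * L⌉₊ + 1 : ℕ) * (ε / 32 / 2)) := by
            apply Real.exp_le_exp.2
            have := Nat.le_ceil (128 * L)
            push_cast
            nlinarith
        _ = Real.exp (ε / 32 / 2) ^ (⌈128 * L⌉₊ + 1) := Real.exp_nat_mul _ _
        _ ≤ _ := by
            gcongr
            exact exp_half_le_one_add (by positivity) (by linarith)
    have h2 : δ * Real.exp (ε * L) = 1 := by
      rw [hLε, Real.exp_log (by positivity)]; field_simp
    have h3 : δ * Real.exp (2 * (ε * L)) = Real.exp (ε * L) := by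
      rw [two_mul, Real.exp_add, ← mul_assoc, h2, one_mul]
    have h4 := Real.add_one_le_exp (ε * L)
    have h5 := mul_le_mul_of_nonneg_left h1 hδ0.le
    have h6 : δ * ε ≤ ε := by nlinarith
    have h7 : ε / 20 ≤ ε * L := by nlinarith
    linarith
  · have he2 : (7 : ℝ) ≤ Real.exp 2 := by
      have h1 := Real.exp_one_gt_d9
      have : Real.exp 2 = Real.exp 1 * Real.exp 1 := by rw [← Real.exp_add]; norm_num
      nlinarith
    have hJ : (3 : ℝ) ^ (⌈128 * L⌉₊ + 1) ≤ Real.exp (2 * (128 * L + 2)) := by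
      calc (3 : ℝ) ^ (⌈128 * L⌉₊ + 1) ≤ Real.exp 2 ^ (⌈128 * L⌉₊ + 1) := by
            gcongr; linarith
        _ = Real.exp ((⌈128 * L⌉₊ + 1 : ℕ) * 2) := (Real.exp_nat_mul _ _).symm
        _ ≤ _ := by
            apply Real.exp_le_exp.2
            have := Nat.ceil_lt_add_one (show 0 ≤ 128 * L by positivity)
            push_cast
            linarith
    have hMle : (⌈48 * Real.exp (2 * L)⌉₊ : ℝ) ≤ Real.exp (2 * L + 4) := by
      have h1 := Nat.ceil_lt_add_one (show 0 ≤ 48 * Real.exp (2 * L) by positivity)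
      have h2 : 1 ≤ Real.exp (2 * L) := Real.one_le_exp (by positivity)
      have h3 : Real.exp 4 = Real.exp 2 * Real.exp 2 := by rw [← Real.exp_add]; norm_num
      have h4 : 49 ≤ Real.exp 4 := by nlinarith
      have h5 := mul_le_mul_of_nonneg_left h4 (zero_le_one.trans h2)
      rw [Real.exp_add]
      linarith
    have hone : (1 : ℝ) ≤ 3 ^ (⌈128 * L⌉₊ + 1) * (⌈48 * Real.exp (2 * L)⌉₊ : ℝ) := by
      exact_mod_cast Nat.succ_le_of_lt (show 0 < 3 ^ (⌈128 * L⌉₊ + 1) *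
        ⌈48 * Real.exp (2 * L)⌉₊ by positivity)
    push_cast
    calc (3 : ℝ) ^ (⌈128 * L⌉₊ + 1) * (⌈48 * Real.exp (2 * L)⌉₊ : ℝ) + 1
        ≤ Real.exp 2 * (3 ^ (⌈128 * L⌉₊ + 1) * (⌈48 * Real.exp (2 * L)⌉₊ : ℝ)) := by nlinarith
      _ ≤ Real.exp 2 * (Real.exp (2 * (128 * L + 2)) * Real.exp (2 * L + 4)) := by gcongr
      _ = Real.exp (2 + (2 * (128 * L + 2) + (2 * L + 4))) := by
          rw [← Real.exp_add, ← Real.exp_add]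
      _ ≤ _ := by
          apply Real.exp_le_exp.2
          linarith

/-- The construction loses no logarithms; for n ≥ 2 the factor allowed in the statement is at least
1. -/
theorem le_mul_logb_rpow {n x y C : ℝ} (hn : 2 ≤ n) (hC : 0 ≤ C) (hy : 0 ≤ y) (h : x ≤ C * y) :
    x ≤ C * y * (Real.logb 2 n) ^ C := by
  have hlog : 1 ≤ Real.logb 2 n := by
    rw [Real.le_logb_iff_rpow_le (by norm_num) (by linarith)]
    simpa using hn
  exact h.trans (le_mul_of_one_le_right (by positivity) (Real.one_le_rpow hlog hC))

end

theorem theorem2 :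
    ∃ C : ℝ, 0 < C ∧ ∀ ε δ : ℝ, 0 < ε → ε ≤ δ → δ ≤ 1 →
      (∃ k : ℕ, 2 ≤ k ∧ (k : ℝ) ≤ max 2 (Real.exp (C * (ε⁻¹ * Real.logb 2 (1 / δ)))) ∧
        ∀ (G : Type u) [AddCommGroup G] [DecidableEq G] (A : Finset G),
          (higherEnergy k A : ℝ) ≤ (#A : ℝ) ^ ((k : ℝ) + δ) ∨
          ∃ H Z : Finset G,
            (#A : ℝ) ^ (δ * (1 - ε)) ≤ C * (#H : ℝ) * (Real.logb 2 (#A : ℝ)) ^ C ∧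
            (#(H + H) : ℝ) ≤ C * (#A : ℝ) ^ ε * (#H : ℝ) ∧
            (#Z : ℝ) * (#H : ℝ) ≤ C * (#A : ℝ) ^ (1 + ε) ∧
            IsDirectSumset H Z ∧
            (#A : ℝ) ^ (1 - ε) ≤ C * (#((H + Z) ∩ A) : ℝ)) ∧
      (∃ k : ℕ, 2 ≤ k ∧ (k : ℝ) ≤ C / ε ∧
        ∀ (G : Type u) [AddCommGroup G] [DecidableEq G] (A : Finset G),
          (higherEnergy k A : ℝ) ≤ (#A : ℝ) ^ ((k : ℝ) + δ) ∨
          ∃ A' P : Finset G,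
            A' ⊆ A ∧
            (#A : ℝ) ^ (1 - ε) ≤ C * (#A' : ℝ) ∧
            (#A : ℝ) ^ δ ≤ C * (#P : ℝ) * (Real.logb 2 (#A : ℝ)) ^ C ∧
            ∀ x ∈ A', (#P : ℝ) * (#A : ℝ) ^ (-ε) ≤ C * (diffRep A P x : ℝ)) := by
  obtain ⟨C, hC⟩ : ∃ C : ℝ, C = 2 ^ 110 := ⟨_, rfl⟩
  have hC0 : 0 < C := by rw [hC]; positivity
  have hC4 : 1000 ≤ C := by rw [hC]; norm_num
  refine ⟨C, hC0, ?_⟩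
  intro ε δ hε hεδ hδ
  have hδ0 : 0 < δ := hε.trans_le hεδ
  have hε1 : ε ≤ 1 := hεδ.trans hδ
  have hlog : 0 ≤ Real.log (1 / δ) := Real.log_nonneg (by rw [le_div_iff₀ hδ0]; linarith)
  constructor
  · have key : ∃ k : ℕ, 2 ≤ k ∧
        (k : ℝ) ≤ max 2 (Real.exp (C * (ε⁻¹ * Real.logb 2 (1 / δ)))) ∧
        ∀ (G : Type u) [AddCommGroup G] [DecidableEq G] (A : Finset G), A.Nonempty →
          (#A : ℝ) ^ ((k : ℝ) + δ) < higherEnergy k A →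
          ∃ H Z : Finset G, (#A : ℝ) ^ (δ * (1 - ε)) ≤ C * (#H : ℝ) ∧
            (#(H + H) : ℝ) ≤ C * (#A : ℝ) ^ ε * (#H : ℝ) ∧
            (#Z : ℝ) * (#H : ℝ) ≤ C * (#A : ℝ) ^ (1 + ε) ∧ IsDirectSumset H Z ∧
            (#A : ℝ) ^ (1 - ε) ≤ C * (#((H + Z) ∩ A) : ℝ) := by
      -- Below the threshold, 1 - δ ≤ log(1/δ) < ε/20, which is the hypothesis of the k = 2
      -- argument.
      obtain hL | hL := le_or_gt (1 / 20) (ε⁻¹ * Real.log (1 / δ))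
      · obtain ⟨J, M, hM0, hM, hJ, hk⟩ := exists_parameters hε hε1 hδ0 hδ hL
        refine ⟨3 ^ (J + 1) * M + 1, ?_, hk.trans (le_max_of_le_right ?_), ?_⟩
        · have : 0 < 3 ^ (J + 1) * M := by positivity
          omega
        · apply Real.exp_le_exp.2
          have h2 : Real.log (1 / δ) ≤ Real.logb 2 (1 / δ) := by
            rw [Real.logb, le_div_iff₀ (Real.log_pos (by norm_num))]
            have := Real.log_two_lt_d9
            nlinarith
          gcongr
        · intro G _ _ A hA hE
          exact exists_structure_of_lt_higherEnergy hA hε hε1 hδ0 hδ hC.ge hM0 hM hJ hE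
      · refine ⟨2, le_rfl, by simp, ?_⟩
        intro G _ _ A hA hE
        refine exists_small_doubling_subset_of_lt_higherEnergy hA hε hεδ ?_ hC.ge hE
        have h1 : Real.log (1 / δ) < ε * (1 / 20) := by rwa [inv_mul_lt_iff₀ hε] at hL
        have h2 := Real.log_le_sub_one_of_pos hδ0
        rw [one_div, Real.log_inv] at h1
        linarith
    obtain ⟨k, hk, hkle, hmain⟩ := key
    refine ⟨k, hk, hkle, ?_⟩
    intro G _ _ A
    obtain hA | hA := le_or_gt (#A) 1
    · exact Or.inl (higherEnergy_le_of_card_le_one hA)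
    obtain hE | hE := le_or_gt (higherEnergy k A : ℝ) ((#A : ℝ) ^ ((k : ℝ) + δ))
    · exact Or.inl hE
    obtain ⟨H, Z, h1, h2⟩ := hmain G A (Finset.card_pos.1 (by omega)) hE
    exact Or.inr ⟨H, Z, le_mul_logb_rpow (by exact_mod_cast hA) hC0.le (by positivity) h1, h2⟩
  · have hinv : 1 ≤ 1 / ε := by rw [le_div_iff₀ hε]; linarith
    have hpos : 0 < ⌈1 / ε⌉₊ := Nat.ceil_pos.2 (by positivity)
    -- With m = k - 1 ≥ 1/ε, the root θ is at least n^(-ε)/2.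
    refine ⟨⌈1 / ε⌉₊ + 1, by omega, ?_, ?_⟩
    · have := Nat.ceil_lt_add_one (show 0 ≤ 1 / ε by positivity)
      push_cast
      rw [div_eq_mul_one_div C]
      nlinarith
    intro G _ _ A
    obtain hA | hA := le_or_gt (#A) 1
    · exact Or.inl (higherEnergy_le_of_card_le_one hA)
    obtain hE | hE := le_or_gt (higherEnergy (⌈1 / ε⌉₊ + 1) A : ℝ)
      ((#A : ℝ) ^ (((⌈1 / ε⌉₊ + 1 : ℕ) : ℝ) + δ))
    · exact Or.inl hE
    have hεm : 1 ≤ ε * (⌈1 / ε⌉₊ : ℝ) := by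
      have := Nat.le_ceil (1 / ε)
      rwa [div_le_iff₀' hε] at this
    obtain ⟨A', P, hA', h1, h2, h3⟩ := exists_popular_subset_of_lt_higherEnergy
      (Finset.card_pos.1 (by omega)) hpos hδ0.le hδ hεm hE
    refine Or.inr ⟨A', P, hA', h1.trans ?_, le_mul_logb_rpow (by exact_mod_cast hA) hC0.le
      (by positivity) (h2.trans ?_), fun x hx => (h3 x hx).trans ?_⟩
    all_goals gcongr; linarith
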